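/- **Setting.** A ribbon graph $\mathbb G=(V,E)$ is a finite orientable surface with boundary, not necessarily connected, represented as the union of a set $V$ of discs (vertices) and a set $E$ of discs (edges), where vertices and edges meet in disjoint arcs, each such arc lies on the boundary of exactly one vertex and one edge, and every edge contains exactly two such arcs. Let $F$ be its set of boundary components. For $A\subseteq E$ put $A^c=E\setminus A$ and let $\mathbb G|A=(V,A)$. The dual $\mathbb G^*$ is obtained by capping off every boundary component with a disc: these discs are its vertices, and its edges are those of $\mathbb G$. The ribbon graph $\mathbb G\backslash e$ is $(V,E\setminus e)$, and $\mathbb G/e$ is obtained by gluing a disc (a new vertex) to each boundary curve of the union of $e$ and its end vertices and then deleting $e$ and its end vertices. A *packaged ribbon graph* $\underline{\mathbb G}=(\mathbb G,\mathcal V,\omega_{\mathcal V},\mathcal F,\omega_{\mathcal F})$ is a ribbon graph with partitions $\mathcal V$ of $V$ and $\mathcal F$ of $F$ and weights $\omega_{\mathcal V}:\mathcal V\to\mathbb N_0$, $\omega_{\mathcal F}:\mathcal F\to\mathbb N_0$. Write $[a]$ for the block of $a$ and $|[a]|$ for its number of elements. For $e\in E$, let $\eta(e)$ be the number of blocks of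 $\mathcal F$ that contain a boundary component meeting $e$, and $\mu(e)$ the number of blocks of $\mathcal V$ that contain a vertex incident to $e$. *Deletion.* $\underline{\mathbb G}\backslash e$ has underlying ribbon graph $\mathbb G\backslash e$ and the same $\mathcal V$, $\omega_{\mathcal V}$. Deleting $e$ replaces the boundary components $f,g$ that meet $e$ (possibly $f=g$) by one or two new ones. In $\mathcal F$, the block or blocks $[f],[g]$ are replaced by one block, which consists of the elements of $[f]\cup[g]$ other than $f,g$ together with the new boundary components; its weight is $\omega_{\mathcal F}([f])+1$ if $[f]=[g]$, and $\omega_{\mathcal F}([f])+\omega_{\mathcal F}([g])$ if $[f]\ne[g]$. Other blocks and their weights are unchanged. *Contraction.* $\underline{\mathbb G}/e$ has underlying ribbon graph $\mathbb G/e$; its boundary components correspond naturally to those of $\mathbb G$, and $\mathcal F$, $\omega_{\mathcal F}$ are carried over. With $u,v$ the end vertices of $e$ (possibly $u=v$), the block or blocks $[u],[v]$ of $\mathcal V$ are replaced by one block, which consists of the elements of $[u]\cup[v]$ other than $u,v$ together with the new vertices; its weight is $\omega_{\mathcal V}([u])+1$ if $[u]=[v]$, and $\omega_{\mathcal V}([u])+\omega_{\mathcal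 V}([v])$ if $[u]\neq[v]$. Other blocks and their weights are unchanged. *Packaging.* $G(\mathbb G;\mathcal V)$ is the multigraph with vertex set $\mathcal V$ and an edge joining $[u]$ and $[v]$ for each edge of $\mathbb G$ with end vertices $u,v$, with vertex weights $\omega_{\mathcal V}$. Since the vertices of $\mathbb G^*$ correspond to the elements of $F$, $G(\mathbb G^*|B;\mathcal F)$, with vertex weights $\omega_{\mathcal F}$, is defined in the same way for $B\subseteq E$. For a graph with $v$ vertices, $e$ edges and $k$ connected components let $n=e-v+k$ be its nullity. For a connected component $K$ of $G(\mathbb G|A;\mathcal V)$ let $$g(\mathbb G,K)=\tfrac12\bigl(2+e(K)-v(K)+\omega_{\mathcal V}(K)-f(\mathbb G[K])\bigr)\in\tfrac12\mathbb Z,$$ where $\omega_{\mathcal V}(K)$ is the total weight of the vertices of $K$ and $f(\mathbb G[K])$ is the number of boundary components of the ribbon subgraph formed by all vertices of $\mathbb G$ in the blocks in $K$ and the edges of $\mathbb G$ corresponding to those of $K$; define $g(\mathbb G^*,H)$ for a connected component $H$ of $G(\mathbb G^*|A^c;\mathcal F)$ likewise, with $\omega_{\mathcal F}$. The *packaged surface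 Tutte polynomial*, in the variables $x,y$ and $x_i,y_i$ for $i\in\frac12\mathbb Z$, with integer coefficients, is $$\boldsymbol T(\underline{\mathbb G};\boldsymbol x,\boldsymbol y)=\sum_{A\subseteq E}x^{n(G(\mathbb G^*|A^c;\mathcal F))}\,y^{n(G(\mathbb G|A;\mathcal V))}\prod_{H}x_{g(\mathbb G^*,H)}\prod_{K}y_{g(\mathbb G,K)},$$ where $H$ runs over the connected components of $G(\mathbb G^*|A^c;\mathcal F)$ and $K$ over those of $G(\mathbb G|A;\mathcal V)$. **Theorem.** Let $\underline{\mathbb G}$ be a packaged ribbon graph. For every edge $e\in E$, $$\boldsymbol T(\underline{\mathbb G};\boldsymbol x,\boldsymbol y)=x^{2-\eta(e)}\,\boldsymbol T(\underline{\mathbb G}\backslash e;\boldsymbol x,\boldsymbol y)+y^{2-\mu(e)}\,\boldsymbol T(\underline{\mathbb G}/e;\boldsymbol x,\boldsymbol y).$$ If $\mathbb G$ has no edges, then $$\boldsymbol T(\underline{\mathbb G};\boldsymbol x,\boldsymbol y)=\prod_{[f]\in\mathcal F}x_{(1-|[f]|+\omega_{\mathcal F}([f]))/2}\ \prod_{[v]\in\mathcal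 V}y_{(1-|[v]|+\omega_{\mathcal V}([v]))/2}.$$ -/

import Mathlib

universe u

/-! ### Ribbon graphs -/

/-- A finite orientable ribbon graph, up to homeomorphism, after choosing an orientation and marking
finitely many disjoint arcs on the boundary circles of its vertex discs, at least one on each circle.
`rot` sends every arc to the next arc on the same vertex boundary (in the direction of the
orientation), and `ends (e, false)`, `ends (e, true)` are the two arcs along which the edge disc `e`
is glued, compatibly with the orientation. An arc that is not of this form is blank: nothing
is glued to it, and it does not change the surface. In particular an isolated vertex is a cycle of
`rot` all of whose arcs are blank. Loops and parallel edges are allowed, and so are disconnected and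
empty ribbon graphs. -/
structure RibbonGraph where
  Arc : Type u
  Edge : Type u
  [arc_finite : Finite Arc]
  [edge_finite : Finite Edge]
  rot : Equiv.Perm Arc
  ends : Edge × Bool ↪ Arc

/-- The set of cycles of a permutation, fixed points included. -/
abbrev CycleSet {D : Type u} (σ : Equiv.Perm D) : Type u :=
  Quotient (Equiv.Perm.SameCycle.setoid σ)

/-- The cycle of `σ` that contains `a`. -/
abbrev cycleThrough {D : Type u} (σ : Equiv.Perm D) (a : D) : CycleSet σ :=
  Quotient.mk (Equiv.Perm.SameCycle.setoid σ) a

namespace RibbonGraph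

attribute [instance] RibbonGraph.arc_finite RibbonGraph.edge_finite

/-- Exchanges the two arcs of every edge and fixes the blank arcs. -/
noncomputable def mate (G : RibbonGraph.{u}) : Equiv.Perm G.Arc :=
  Equiv.Perm.viaEmbedding ((Equiv.refl G.Edge).prodCongr Equiv.boolNot) G.ends

/-- The vertices: one for each boundary circle of a vertex disc. -/
abbrev Vertex (G : RibbonGraph.{u}) : Type u := CycleSet G.rot

/-- The permutation that follows the boundary of the surface. After arriving at an arc `a`
that carries an edge, the boundary runs along a side of this edge to the other arc
`mate a` of the edge, and then along the vertex boundary to the next arc `rot (mate a)`. If `a` is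
blank, then `mate a = a` and the boundary continues through `a` to `rot a`. -/
noncomputable def bdry (G : RibbonGraph.{u}) : Equiv.Perm G.Arc := G.rot * G.mate

/-- The boundary components of the surface. -/
noncomputable abbrev BdryComp (G : RibbonGraph.{u}) : Type u := CycleSet G.bdry

/-- The vertex whose boundary contains the arc `a`. -/
abbrev vertexAt (G : RibbonGraph.{u}) (a : G.Arc) : G.Vertex := cycleThrough G.rot a

/-- The boundary component that visits the arc `a`. -/
noncomputable abbrev bdryAt (G : RibbonGraph.{u}) (a : G.Arc) : G.BdryComp := cycleThrough G.bdry a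

/-- The vertex `w` is incident to the edge `e`. -/
def Incident (G : RibbonGraph.{u}) (w : G.Vertex) (e : G.Edge) : Prop :=
  ∃ i : Bool, w = G.vertexAt (G.ends (e, i))

/-- The boundary component `f` intersects the edge `e`: it contains one of the two sides of `e`,
where the side that starts at the arc `ends (e, i)` is numbered `i`. -/
def Meets (G : RibbonGraph.{u}) (f : G.BdryComp) (e : G.Edge) : Prop :=
  ∃ i : Bool, f = G.bdryAt (G.ends (e, i))

/-- The gluing arcs of the edges in `A` only. -/
def endsOn (G : RibbonGraph.{u}) (A : Set G.Edge) : ↥A × Bool ↪ G.Arc :=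
  ((Function.Embedding.subtype (· ∈ A)).prodMap (Function.Embedding.refl Bool)).trans G.ends

/-- The spanning ribbon subgraph with edge set `A`: the same vertices, only the edges in `A`. The
arcs of the other edges become blank. -/
def restrict (G : RibbonGraph.{u}) (A : Set G.Edge) : RibbonGraph.{u} where
  Arc := G.Arc
  Edge := ↥A
  rot := G.rot
  ends := G.endsOn A

/-- Deletion of the edge `e`. -/
def delete (G : RibbonGraph.{u}) (e : G.Edge) : RibbonGraph.{u} := G.restrict {e}ᶜ

open scoped Classical in
/-- Contraction of the edge `e`: the end vertices of `e` and `e` itself are replaced by discs that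
are glued to the boundary curves of their union. These curves, together with the boundaries of the
other vertices, are the cycles of `rot` composed with the exchange of the two arcs of `e`. -/
noncomputable def contract (G : RibbonGraph.{u}) (e : G.Edge) : RibbonGraph.{u} where
  Arc := G.Arc
  Edge := ↥({e}ᶜ : Set G.Edge)
  rot := G.rot * Equiv.swap (G.ends (e, false)) (G.ends (e, true))
  ends := G.endsOn {e}ᶜ

/-- The geometric dual: its vertex discs cap off the boundary components, and its edges are the same
discs, glued to the new vertices along their other two sides. The side of `e` that starts at the
arc `a` is again called `a`. -/
noncomputable def dual (G : RibbonGraph.{u}) : RibbonGraph.{u} where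
  Arc := G.Arc
  Edge := G.Edge
  rot := G.bdry
  ends := G.ends

/-- The ribbon subgraph that consists of the vertices in `U` and of all edges with both ends
in `U`. -/
def induce (G : RibbonGraph.{u}) (U : Set G.Vertex) : RibbonGraph.{u} where
  Arc := {a : G.Arc // G.vertexAt a ∈ U}
  Edge := {e : G.Edge // ∀ i : Bool, G.vertexAt (G.ends (e, i)) ∈ U}
  rot := G.rot.subtypePerm (fun a => by
    have h : G.vertexAt (G.rot a) = G.vertexAt a :=
      Quotient.sound (Equiv.Perm.sameCycle_apply_left.2 (Equiv.Perm.SameCycle.refl _ _))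
    rw [h])
  ends :=
    { toFun := fun p => ⟨G.ends (p.1.1, p.2), p.1.2 p.2⟩
      inj' := by
        rintro ⟨⟨e, he⟩, i⟩ ⟨⟨e', he'⟩, i'⟩ h
        have h' := G.ends.injective (Subtype.mk.inj h)
        simp only [Prod.mk.injEq] at h'
        obtain ⟨rfl, rfl⟩ := h'
        rfl }

theorem mate_ends (G : RibbonGraph.{u}) (e : G.Edge) (i : Bool) :
    G.mate (G.ends (e, i)) = G.ends (e, !i) := by
  rw [mate, Equiv.Perm.viaEmbedding_apply]
  rfl

theorem mate_of_notMem (G : RibbonGraph.{u}) (a : G.Arc) (h : a ∉ Set.range G.ends) :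
    G.mate a = a :=
  Equiv.Perm.viaEmbedding_apply_of_notMem _ _ _ h

/-- Exchanges the two arcs of every edge other than `e`. -/
noncomputable def mateWithout (G : RibbonGraph.{u}) (e : G.Edge) : Equiv.Perm G.Arc :=
  (G.delete e).mate

open scoped Classical in
theorem swap_mul_mate_delete (G : RibbonGraph.{u}) (e : G.Edge) :
    Equiv.swap (G.ends (e, false)) (G.ends (e, true)) *
      G.mateWithout e = G.mate := by
  have key : ∀ (x : ↥({e}ᶜ : Set G.Edge)) (i : Bool),
      G.mateWithout e (G.ends (x.1, i)) = G.ends (x.1, !i) :=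
    fun x i => mate_ends (G.delete e) x i
  have out : ∀ a : G.Arc, (∀ (x : ↥({e}ᶜ : Set G.Edge)) (i : Bool), G.ends (x.1, i) ≠ a) →
      G.mateWithout e a = a := by
    intro a ha
    refine mate_of_notMem (G.delete e) a ?_
    rintro ⟨⟨x, i⟩, hx⟩
    exact ha x i hx
  ext a
  rw [Equiv.Perm.mul_apply]
  by_cases h : a ∈ Set.range G.ends
  · obtain ⟨⟨x, i⟩, rfl⟩ := h
    rw [mate_ends]
    by_cases hx : x = e
    · subst hx
      rw [out]
      · cases i <;> simp
      · intro y j hy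
        exact y.2 (Prod.mk.inj (G.ends.injective hy)).1
    · rw [key ⟨x, hx⟩ i, Equiv.swap_apply_of_ne_of_ne] <;>
      · intro hy
        exact hx (Prod.mk.inj (G.ends.injective hy)).1
  · rw [mate_of_notMem G a h, out, Equiv.swap_apply_of_ne_of_ne]
    · rintro rfl
      exact h ⟨_, rfl⟩
    · rintro rfl
      exact h ⟨_, rfl⟩
    · rintro y j rfl
      exact h ⟨_, rfl⟩

open scoped Classical in
theorem bdry_delete (G : RibbonGraph.{u}) (e : G.Edge) :
    ((G.delete e).bdry : Equiv.Perm G.Arc) =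
      G.bdry * Equiv.swap (G.ends (e, false)) (G.ends (e, true)) := by
  have h1 := G.swap_mul_mate_delete e
  have hm : G.mate * G.mate = 1 := by
    ext a
    rw [Equiv.Perm.mul_apply]
    by_cases h : a ∈ Set.range G.ends
    · obtain ⟨⟨x, i⟩, rfl⟩ := h
      rw [mate_ends, mate_ends, Bool.not_not]
      rfl
    · rw [mate_of_notMem G a h, mate_of_notMem G a h]
      rfl
  have hm' : G.mateWithout e * G.mateWithout e = 1 := by
    ext a
    rw [Equiv.Perm.mul_apply]
    change (G.delete e).mate ((G.delete e).mate a) = a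
    by_cases h : a ∈ Set.range (G.delete e).ends
    · obtain ⟨⟨x, i⟩, rfl⟩ := h
      rw [mate_ends, mate_ends, Bool.not_not]
    · rw [mate_of_notMem (G.delete e) a h, mate_of_notMem (G.delete e) a h]
  change G.rot * G.mateWithout e = G.rot * G.mate * _
  rw [mul_assoc]
  congr 1
  have h2 : Equiv.swap (G.ends (e, false)) (G.ends (e, true)) =
      G.mate * G.mateWithout e := by
    rw [← h1, mul_assoc, hm', mul_one]
  rw [h2, ← mul_assoc, hm, one_mul]

theorem bdry_contract (G : RibbonGraph.{u}) (e : G.Edge) :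
    ((G.contract e).bdry : Equiv.Perm G.Arc) = G.bdry := by
  classical
  change G.rot * Equiv.swap (G.ends (e, false)) (G.ends (e, true)) *
    G.mateWithout e = G.rot * G.mate
  rw [mul_assoc]
  congr 1
  convert G.swap_mul_mate_delete e

end RibbonGraph

/-! ### Weighted partitions and packaged ribbon graphs -/

/-- A partition of `X`, given by its equivalence relation, with a weight on each of its blocks. -/
structure WeightedPartition (X : Type u) where
  rel : Setoid X
  weight : Quotient rel → ℕ

namespace WeightedPartition

/-- The set of blocks. -/
abbrev Block {X : Type u} (P : WeightedPartition X) : Type u := Quotient P.rel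

/-- The block that contains `x`. -/
abbrev block {X : Type u} (P : WeightedPartition X) (x : X) : P.Block := Quotient.mk P.rel x

/-- The number of elements of a block. -/
noncomputable def size {X : Type u} (P : WeightedPartition X) (β : P.Block) : ℕ :=
  Nat.card {x : X // P.block x = β}

open scoped Classical in
/-- The label of an arc `c`: if the cycle of `σ` through `c` is in the block of the cycle through `a`
or in that of the cycle through `b`, it is `none`; otherwise it is `some β`, where `β` is the block
of the cycle through `c`. -/
noncomputable def arcLabel {D : Type u} {σ : Equiv.Perm D} (P : WeightedPartition (CycleSet σ))
    (a b c : D) : Option P.Block :=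
  if P.block (cycleThrough σ c) = P.block (cycleThrough σ a) ∨
      P.block (cycleThrough σ c) = P.block (cycleThrough σ b)
  then none else some (P.block (cycleThrough σ c))

open scoped Classical in
theorem arcLabel_eq {D : Type u} {σ τ : Equiv.Perm D} (P : WeightedPartition (CycleSet σ))
    (a b : D) (h : τ = σ * Equiv.swap a b) (c d : D) (hcd : τ.SameCycle c d) :
    P.arcLabel a b c = P.arcLabel a b d := by
  have hσ : ∀ c, cycleThrough σ (σ c) = cycleThrough σ c := fun c =>
    Quotient.sound (Equiv.Perm.sameCycle_apply_left.2 (Equiv.Perm.SameCycle.refl _ _))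
  have step : ∀ c, P.arcLabel a b (τ c) = P.arcLabel a b c := by
    intro c
    subst h
    rw [Equiv.Perm.mul_apply]
    by_cases ha : c = a
    · subst ha
      simp [arcLabel, hσ]
    · by_cases hb : c = b
      · subst hb
        simp [arcLabel, hσ]
      · rw [Equiv.swap_apply_of_ne_of_ne ha hb]
        simp only [arcLabel, hσ]
  have inv : ∀ c, P.arcLabel a b (τ⁻¹ c) = P.arcLabel a b c := fun c => by
    rw [← step (τ⁻¹ c), ← Equiv.Perm.mul_apply, mul_inv_cancel, Equiv.Perm.one_apply]
  obtain ⟨n, rfl⟩ := hcd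
  induction n with
  | zero => rfl
  | succ n ih => rw [ih, add_comm, zpow_add, Equiv.Perm.mul_apply, zpow_one, step]
  | pred n ih => rw [ih, sub_eq_add_neg, add_comm, zpow_add, Equiv.Perm.mul_apply, zpow_neg_one, inv]

open scoped Classical in
/-- The block of the old partition to which a cycle of `τ = σ * swap a b` belongs, or `none` if it
belongs to the new block. The cycles of `τ` that avoid `a` and `b` are cycles of `σ`. -/
noncomputable def cycleLabel {D : Type u} {σ τ : Equiv.Perm D} (P : WeightedPartition (CycleSet σ))
    (a b : D) (h : τ = σ * Equiv.swap a b) : CycleSet τ → Option P.Block :=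
  Quotient.lift (P.arcLabel a b) (P.arcLabel_eq a b h)

open scoped Classical in
/-- The weight of the new block: `ω([a]) + 1` if `[a] = [b]`, and `ω([a]) + ω([b])` otherwise. -/
noncomputable def newWeight {D : Type u} {σ : Equiv.Perm D} (P : WeightedPartition (CycleSet σ))
    (a b : D) : ℕ :=
  if P.block (cycleThrough σ a) = P.block (cycleThrough σ b)
  then P.weight (P.block (cycleThrough σ a)) + 1
  else P.weight (P.block (cycleThrough σ a)) + P.weight (P.block (cycleThrough σ b))

open scoped Classical in
/-- Passing from the cycles of `σ` to those of `τ = σ * swap a b` either splits a cycle through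
`a` and `b` in two or joins two such cycles. In the new partition, the blocks of the cycles
through `a` and through `b` (one block or two) are replaced by a single block, which consists of
the remaining cycles in them and the newly formed cycles. All other blocks keep their elements and
their weights. -/
noncomputable def merge {D : Type u} {σ τ : Equiv.Perm D} (P : WeightedPartition (CycleSet σ))
    (a b : D) (h : τ = σ * Equiv.swap a b) : WeightedPartition (CycleSet τ) where
  rel := Setoid.ker (P.cycleLabel a b h)
  weight := Quotient.lift
    (fun c => match P.cycleLabel a b h c with
      | none => P.newWeight a b
      | some β => P.weight β)
    (fun c d (hcd : P.cycleLabel a b h c = P.cycleLabel a b h d) => by simp only [hcd])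

end WeightedPartition

/-- A packaged ribbon graph: a ribbon graph with weighted partitions of its vertices and of its
boundary components. -/
structure PackagedRibbonGraph where
  graph : RibbonGraph.{u}
  vert : WeightedPartition graph.Vertex
  face : WeightedPartition graph.BdryComp

namespace PackagedRibbonGraph

/-- Deletion of the edge `e`. The vertices and their partition are unchanged. The boundary component
or components that meet `e` are split in two or joined, and their blocks become one block. -/
noncomputable def delete (P : PackagedRibbonGraph.{u}) (e : P.graph.Edge) :
    PackagedRibbonGraph.{u} where
  graph := P.graph.delete e
  vert := P.vert
  face := P.face.merge (P.graph.ends (e, false)) (P.graph.ends (e, true)) (P.graph.bdry_delete e)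

/-- Contraction of the edge `e`. The end vertex or vertices of `e` are split in two or joined, and
their blocks become one block. The boundary components are unchanged: they are the cycles of the
same permutation. -/
noncomputable def contract (P : PackagedRibbonGraph.{u}) (e : P.graph.Edge) :
    PackagedRibbonGraph.{u} where
  graph := P.graph.contract e
  vert := P.vert.merge (P.graph.ends (e, false)) (P.graph.ends (e, true)) rfl
  face := cast (congrArg (fun σ : Equiv.Perm P.graph.Arc => WeightedPartition (CycleSet σ))
    (P.graph.bdry_contract e).symm) P.face

/-- The number of blocks that contain a boundary component meeting `e`. -/
noncomputable def eta (P : PackagedRibbonGraph.{u}) (e : P.graph.Edge) : ℕ :=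
  Set.ncard {β : P.face.Block | ∃ f : P.graph.BdryComp, P.graph.Meets f e ∧ P.face.block f = β}

/-- The number of blocks that contain a vertex incident to `e`. -/
noncomputable def mu (P : PackagedRibbonGraph.{u}) (e : P.graph.Edge) : ℕ :=
  Set.ncard {β : P.vert.Block | ∃ w : P.graph.Vertex, P.graph.Incident w e ∧ P.vert.block w = β}

end PackagedRibbonGraph

/-! ### Packagings -/

/-- A vertex-weighted multigraph. The two ends of an edge are listed in an arbitrary order. -/
structure WeightedMultigraph where
  Vertex : Type u
  Edge : Type u
  fst : Edge → Vertex
  snd : Edge → Vertex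
  weight : Vertex → ℕ

namespace WeightedMultigraph

/-- The connected components: the classes of the equivalence relation on vertices that is generated
by adjacency. -/
def Component (K : WeightedMultigraph.{u}) : Type u :=
  Quot (fun p q : K.Vertex => ∃ e : K.Edge, K.fst e = p ∧ K.snd e = q)

/-- The component that contains the vertex `p`. -/
def component (K : WeightedMultigraph.{u}) (p : K.Vertex) : K.Component := Quot.mk _ p

/-- The nullity `e - v + k`; here `v ≤ e + k` always holds for finite graphs. -/
noncomputable def nullity (K : WeightedMultigraph.{u}) : ℕ :=
  Nat.card K.Edge + Nat.card K.Component - Nat.card K.Vertex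

/-- The number of vertices of a component. -/
noncomputable def numVertices (K : WeightedMultigraph.{u}) (c : K.Component) : ℕ :=
  Nat.card {p : K.Vertex // K.component p = c}

/-- The number of edges of a component. -/
noncomputable def numEdges (K : WeightedMultigraph.{u}) (c : K.Component) : ℕ :=
  Nat.card {e : K.Edge // K.component (K.fst e) = c}

/-- The total weight of the vertices of a component. -/
noncomputable def totalWeight (K : WeightedMultigraph.{u}) (c : K.Component) : ℕ :=
  ∑ᶠ p : {p : K.Vertex // K.component p = c}, K.weight p.1

end WeightedMultigraph

namespace RibbonGraph

/-- The packaging of a ribbon graph by a weighted partition of its vertices: the vertices are the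
blocks, and every edge joins the blocks of its end vertices. -/
def packaging (G : RibbonGraph.{u}) (P : WeightedPartition G.Vertex) : WeightedMultigraph.{u} where
  Vertex := P.Block
  Edge := G.Edge
  fst e := P.block (G.vertexAt (G.ends (e, false)))
  snd e := P.block (G.vertexAt (G.ends (e, true)))
  weight := P.weight

/-- The ribbon subgraph that corresponds to a component `c` of the packaging. -/
def componentSubgraph (G : RibbonGraph.{u}) (P : WeightedPartition G.Vertex)
    (c : (G.packaging P).Component) : RibbonGraph.{u} :=
  G.induce {w | (G.packaging P).component (P.block w) = c}

/-- The genus index `(2 k + e - v + ω - f) / 2` of a component `c` of the packaging, where `k = 1`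
is its number of components and `f` is the number of boundary components of the ribbon subgraph
that corresponds to it. It is half an integer and may be negative. -/
noncomputable def genusIndex (G : RibbonGraph.{u}) (P : WeightedPartition G.Vertex)
    (c : (G.packaging P).Component) : ℚ :=
  (2 * 1 + ((G.packaging P).numEdges c : ℚ) - ((G.packaging P).numVertices c : ℚ)
    + ((G.packaging P).totalWeight c : ℚ)
    - (Nat.card (G.componentSubgraph P c).BdryComp : ℚ)) / 2

end RibbonGraph

/-! ### The packaged surface Tutte polynomial -/

/-- The variables `x`, `y` and, for every index `i`, `x_i` and `y_i`. Only the variables whose index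
is half an integer occur in the polynomials below. -/
inductive TutteVar : Type
  | x : TutteVar
  | y : TutteVar
  | xIdx : ℚ → TutteVar
  | yIdx : ℚ → TutteVar

namespace PackagedRibbonGraph

/-- The packaged surface Tutte polynomial: a sum over all subsets `A` of the edge set. -/
noncomputable def tutte (P : PackagedRibbonGraph.{u}) : MvPolynomial TutteVar ℤ :=
  ∑ᶠ A : Set P.graph.Edge,
    MvPolynomial.X TutteVar.x ^ ((P.graph.dual.restrict Aᶜ).packaging P.face).nullity *
    MvPolynomial.X TutteVar.y ^ ((P.graph.restrict A).packaging P.vert).nullity *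
    (∏ᶠ H : ((P.graph.dual.restrict Aᶜ).packaging P.face).Component,
      MvPolynomial.X (TutteVar.xIdx ((P.graph.dual.restrict Aᶜ).genusIndex P.face H))) *
    (∏ᶠ K : ((P.graph.restrict A).packaging P.vert).Component,
      MvPolynomial.X (TutteVar.yIdx ((P.graph.restrict A).genusIndex P.vert K)))

end PackagedRibbonGraph

/-! The summand of a set `A` is a product of two factors of the same shape, `packagingTerm`: one for
the dual restricted to `Aᶜ` with the face partition, one for the graph restricted to `A` with the
vertex partition. The edge `e` lies in exactly one of `A` and `Aᶜ`. If `e ∉ A`, deleting `e`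
contracts it in the dual packaging and leaves the other packaging alone; if `e ∈ A`, contracting `e`
does the reverse. So everything rests on how one factor behaves when an edge of its packaging is
contracted (`packagingTerm_contract`).

Components correspond, and the nullity drops by one exactly if the edge is a loop, which gives the
exponents `2 - η` and `2 - μ`. On the component of the edge, `e - v + ω` is preserved: a loop trades
an edge for a unit of weight, while another edge disappears together with one vertex and the weights
add up. The number of boundary components is preserved because contraction moves a transposition
from `mate` into `rot`, leaving the product `bdry` the same. Hence all genus indices agree.

A single lemma serves both sides, since deletion multiplies `bdry`, the rotation of the dual, by the
same transposition by which contraction multiplies `rot`. -/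

namespace WeightedMultigraph

/-! ### Contraction of an edge in a weighted multigraph. -/

instance (K : WeightedMultigraph.{u}) [Finite K.Vertex] : Finite K.Component :=
  inferInstanceAs (Finite (Quot _))

theorem component_fst (K : WeightedMultigraph.{u}) (e : K.Edge) :
    K.component (K.fst e) = K.component (K.snd e) :=
  Quot.sound ⟨e, rfl, rfl⟩

/-- The nullity of a finite graph is not negative. -/
theorem card_vertex_le (K : WeightedMultigraph.{u}) [Finite K.Vertex] [Finite K.Edge] :
    Nat.card K.Vertex ≤ Nat.card K.Edge + Nat.card K.Component := by
  classical
  have := Fintype.ofFinite K.Vertex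
  have := Fintype.ofFinite K.Edge
  have := Fintype.ofFinite K.Component
  -- The coboundary map. Functions in its kernel are constant on components, so the kernel has
  -- dimension at most `k`; rank-nullity then gives `v ≤ e + k`.
  let d : (K.Vertex → ℚ) →ₗ[ℚ] (K.Edge → ℚ) :=
    LinearMap.funLeft ℚ ℚ K.fst - LinearMap.funLeft ℚ ℚ K.snd
  have hd : ∀ f ∈ LinearMap.ker d, ∀ e, f (K.fst e) = f (K.snd e) := by
    intro f hf e
    have := congrFun (LinearMap.mem_ker.1 hf) e
    simpa [d, LinearMap.funLeft_apply, sub_eq_zero] using this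
  have hle : LinearMap.ker d ≤
      LinearMap.range (LinearMap.funLeft ℚ ℚ K.component) := by
    intro f hf
    refine ⟨Quot.lift f ?_, rfl⟩
    rintro _ _ ⟨e, rfl, rfl⟩
    exact hd f hf e
  have h1 := Submodule.finrank_mono hle
  have h2 := LinearMap.finrank_range_le (LinearMap.funLeft ℚ ℚ K.component)
  have h3 := d.finrank_range_add_finrank_ker
  have h4 := Submodule.finrank_le (LinearMap.range d)
  simp only [Module.finrank_fintype_fun_eq_card] at h2 h3 h4
  simp only [Nat.card_eq_fintype_card]
  omega

open scoped Classical in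
/-- `K'` arises from `K` by contracting the edge `e`: `vmap` identifies the ends of `e` and nothing
else, and the weight of the new vertex is the sum of the weights of the ends of `e`, or
the weight of the end of `e` plus one if `e` is a loop. -/
structure IsContraction (K K' : WeightedMultigraph.{u}) (e : K.Edge) (vmap : K.Vertex → K'.Vertex)
    (emap : K'.Edge ≃ ↥({e}ᶜ : Set K.Edge)) : Prop where
  surj : Function.Surjective vmap
  vmap_eq_iff : ∀ p q, vmap p = vmap q ↔
    p = q ∨ ((p = K.fst e ∨ p = K.snd e) ∧ (q = K.fst e ∨ q = K.snd e))
  fst_eq : ∀ x, K'.fst x = vmap (K.fst (emap x))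
  snd_eq : ∀ x, K'.snd x = vmap (K.snd (emap x))
  weight_eq : ∀ p, p ≠ K.fst e → p ≠ K.snd e → K'.weight (vmap p) = K.weight p
  weight_new : K'.weight (vmap (K.fst e)) =
    if K.fst e = K.snd e then K.weight (K.fst e) + 1
    else K.weight (K.fst e) + K.weight (K.snd e)

namespace IsContraction

variable {K K' : WeightedMultigraph.{u}} {e : K.Edge} {vmap : K.Vertex → K'.Vertex}
  {emap : K'.Edge ≃ ↥({e}ᶜ : Set K.Edge)}

theorem component_eq (h : IsContraction K K' e vmap emap) {p q : K.Vertex}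
    (hpq : vmap p = vmap q) : K.component p = K.component q := by
  have := K.component_fst e
  rcases (h.vmap_eq_iff p q).1 hpq with rfl | ⟨rfl | rfl, rfl | rfl⟩ <;> simp [this]

theorem vmap_fst (h : IsContraction K K' e vmap emap) : vmap (K.fst e) = vmap (K.snd e) :=
  (h.vmap_eq_iff _ _).2 (by simp)

/-- Contracting an edge does not change the set of components. -/
noncomputable def componentEquiv (h : IsContraction K K' e vmap emap) :
    K.Component ≃ K'.Component where
  toFun := Quot.lift (fun p => K'.component (vmap p)) (by
    rintro _ _ ⟨x, rfl, rfl⟩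
    by_cases hx : x = e
    · subst hx
      rw [h.vmap_fst]
    · have := K'.component_fst (emap.symm ⟨x, hx⟩)
      rwa [h.fst_eq, h.snd_eq, Equiv.apply_symm_apply] at this)
  -- Any preimage will do: two preimages of a vertex are equal or are both ends of `e`, hence lie in
  -- one component.
  invFun := Quot.lift (fun p => K.component (Function.surjInv h.surj p)) (by
    rintro _ _ ⟨x, rfl, rfl⟩
    rw [h.component_eq ((Function.surjInv_eq h.surj _).trans (h.fst_eq x)),
      h.component_eq ((Function.surjInv_eq h.surj _).trans (h.snd_eq x)), K.component_fst])
  left_inv := by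
    rintro ⟨p⟩
    exact h.component_eq (Function.surjInv_eq h.surj _)
  right_inv := by
    rintro ⟨p⟩
    exact congrArg K'.component (Function.surjInv_eq h.surj _)

theorem componentEquiv_component (h : IsContraction K K' e vmap emap) (p : K.Vertex) :
    h.componentEquiv (K.component p) = K'.component (vmap p) := rfl

theorem card_edge (_ : IsContraction K K' e vmap emap) [Finite K.Edge] :
    Nat.card K.Edge = Nat.card K'.Edge + 1 := by
  rw [Nat.card_congr emap, Nat.card_coe_set_eq, ← Set.ncard_add_ncard_compl {e},
    Set.ncard_singleton, add_comm]

theorem numEdges_eq [Finite K.Edge] [DecidableEq K.Component]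
    (h : IsContraction K K' e vmap emap) (c : K.Component) :
    K.numEdges c = K'.numEdges (h.componentEquiv c) +
      if K.component (K.fst e) = c then 1 else 0 := by
  classical
  have := Fintype.ofFinite K.Edge
  have := Finite.of_equiv _ emap.symm
  have := Fintype.ofFinite K'.Edge
  simp only [numEdges, Nat.card_eq_fintype_card, Fintype.card_subtype, Finset.card_filter]
  rw [← Finset.sum_erase_add _ _ (Finset.mem_univ e)]
  congr 1
  symm
  refine Finset.sum_bij (fun x _ => (emap x).1) ?_ ?_ ?_ ?_
  · intro x _
    exact Finset.mem_erase.2 ⟨(emap x).2, Finset.mem_univ _⟩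
  · intro x _ y _ hxy
    exact emap.injective (Subtype.ext hxy)
  · intro x hx
    exact ⟨emap.symm ⟨x, by simpa using hx⟩, Finset.mem_univ _, by simp⟩
  · intro x _
    rw [h.fst_eq, ← componentEquiv_component h]
    simp

/-- Sums over the vertices of a contraction, in terms of the function on the vertices of the
original graph. -/
theorem sum_vertex [Fintype K.Vertex] [Fintype K'.Vertex] [DecidableEq K.Vertex]
    [DecidableEq K'.Vertex] (h : IsContraction K K' e vmap emap) (s : K.Vertex → ℚ)
    (s' : K'.Vertex → ℚ) (t : ℚ) (hs : ∀ p, p ≠ K.fst e → p ≠ K.snd e → s' (vmap p) = s p)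
    (ht : ∑ p ∈ {K.fst e, K.snd e}, s p = s' (vmap (K.fst e)) + t) :
    ∑ p, s p = ∑ p, s' p + t := by
  -- All fibres of `vmap` are singletons except possibly the one over the new vertex, which is the
  -- set of ends of `e`. As a finset this pair collapses for a loop, so `ht` covers both cases.
  rw [← Finset.sum_fiberwise Finset.univ vmap s]
  have key : ∀ p', ∑ p with vmap p = p', s p =
      s' p' + if vmap (K.fst e) = p' then t else 0 := by
    intro p'
    obtain ⟨p, rfl⟩ := h.surj p'
    by_cases hp : p = K.fst e ∨ p = K.snd e
    · have h1 : vmap p = vmap (K.fst e) := (h.vmap_eq_iff _ _).2 (by simp [hp])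
      rw [h1, if_pos rfl, ← ht]
      refine Finset.sum_congr ?_ fun _ _ => rfl
      ext q
      simp only [Finset.mem_filter_univ, Finset.mem_insert, Finset.mem_singleton, h.vmap_eq_iff]
      tauto
    · rw [if_neg, add_zero, hs p (by tauto) (by tauto)]
      · rw [show (Finset.univ.filter fun q => vmap q = vmap p) = {p} from ?_, Finset.sum_singleton]
        ext q
        simp only [Finset.mem_filter_univ, Finset.mem_singleton, h.vmap_eq_iff]
        tauto
      · rw [h.vmap_eq_iff]
        rintro (rfl | h)
        · simp at hp
        · exact hp h.2
  simp [key, Finset.sum_add_distrib]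

open scoped Classical in
theorem card_vertex [Finite K.Vertex] (h : IsContraction K K' e vmap emap) :
    Nat.card K.Vertex = Nat.card K'.Vertex + if K.fst e = K.snd e then 0 else 1 := by
  have := Fintype.ofFinite K.Vertex
  have := Finite.of_surjective _ h.surj
  have := Fintype.ofFinite K'.Vertex
  have := h.sum_vertex (fun _ => 1) (fun _ => 1) (if K.fst e = K.snd e then 0 else 1)
    (fun _ _ _ => rfl) (by
      by_cases he : K.fst e = K.snd e
      · simp [he]
      · rw [Finset.sum_pair he, if_neg he])
  rw [Nat.card_eq_fintype_card, Nat.card_eq_fintype_card]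
  simp only [Finset.sum_const, Finset.card_univ, nsmul_eq_mul, mul_one] at this
  exact_mod_cast this

open scoped Classical in
-- One edge is lost and `k` is unchanged; a vertex is lost as well unless `e` is a loop.
theorem nullity_eq [Finite K.Vertex] [Finite K.Edge] (h : IsContraction K K' e vmap emap) :
    K.nullity = (if K.fst e = K.snd e then 1 else 0) + K'.nullity := by
  have := Finite.of_surjective _ h.surj
  have := Finite.of_equiv _ emap.symm
  have h1 := h.card_edge
  have h2 := h.card_vertex
  have h3 := Nat.card_congr h.componentEquiv
  -- The subtraction in `nullity` is truncated, so the loop case needs this bound for `K'`.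
  have h4 := K'.card_vertex_le
  unfold nullity
  split_ifs at h2 ⊢ <;> omega

end IsContraction

/-- The part `ω - v` of the genus index of a component. -/
theorem totalWeight_sub_numVertices (K : WeightedMultigraph.{u}) [Fintype K.Vertex]
    [DecidableEq K.Component] (c : K.Component) :
    (K.totalWeight c : ℚ) - K.numVertices c =
      ∑ p, if K.component p = c then (K.weight p : ℚ) - 1 else 0 := by
  rw [totalWeight, numVertices, finsum_eq_sum_of_fintype, Nat.card_eq_fintype_card,
    Fintype.card_eq_sum_ones, ← Finset.sum_filter]
  push_cast
  rw [← Finset.sum_sub_distrib]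
  exact Finset.sum_subtype _ (by simp) (fun p => (K.weight p : ℚ) - 1) |>.symm

/-- The weight rule makes `ω - v` grow by one on the component of `e`, for a loop and for a non-loop
alike, which cancels the lost edge. -/
theorem IsContraction.genus_eq {K K' : WeightedMultigraph.{u}} {e : K.Edge}
    {vmap : K.Vertex → K'.Vertex} {emap : K'.Edge ≃ ↥({e}ᶜ : Set K.Edge)}
    [Finite K.Vertex] [Finite K.Edge] (h : IsContraction K K' e vmap emap) (c : K.Component) :
    (K.numEdges c : ℚ) - K.numVertices c + K.totalWeight c =
      K'.numEdges (h.componentEquiv c) - K'.numVertices (h.componentEquiv c) +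
        K'.totalWeight (h.componentEquiv c) := by
  classical
  have := Fintype.ofFinite K.Vertex
  have := Finite.of_surjective _ h.surj
  have := Fintype.ofFinite K'.Vertex
  have h1 := K.totalWeight_sub_numVertices c
  have h2 := K'.totalWeight_sub_numVertices (h.componentEquiv c)
  have h3 : (K.numEdges c : ℚ) = K'.numEdges (h.componentEquiv c) +
      if K.component (K.fst e) = c then 1 else 0 := by
    rw [h.numEdges_eq c]
    push_cast
    rfl
  have h4 := h.sum_vertex
    (fun p => if K.component p = c then (K.weight p : ℚ) - 1 else 0)
    (fun p => if K'.component p = h.componentEquiv c then (K'.weight p : ℚ) - 1 else 0)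
    -- The change of `ω - v`: `w - 1 = ((w + 1) - 1) - 1` for a loop, and `(w - 1) + (w' - 1) = (w +
    -- w' - 1) - 1` otherwise.
    (-if K.component (K.fst e) = c then 1 else 0)
    (fun p hp hq => by
      rw [← componentEquiv_component h, h.weight_eq p hp hq]
      simp only [EmbeddingLike.apply_eq_iff_eq])
    (by
      rw [← componentEquiv_component h, h.weight_new]
      simp only [EmbeddingLike.apply_eq_iff_eq]
      by_cases he : K.fst e = K.snd e
      · simp only [← he, Finset.pair_eq_singleton, Finset.sum_singleton, if_true]
        split_ifs <;> push_cast <;> ring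
      · rw [Finset.sum_pair he, if_neg he, ← K.component_fst e]
        split_ifs <;> push_cast <;> ring)
  linarith

end WeightedMultigraph

/-! ### Cycles of restricted permutations. -/

theorem card_cycleSet_subtypePerm_congr {D : Type u} {σ τ : Equiv.Perm D} {p q : D → Prop}
    (hp : ∀ x, p (σ x) ↔ p x) (hq : ∀ x, q (τ x) ↔ q x) (hστ : σ = τ) (hpq : p = q) :
    Nat.card (CycleSet (σ.subtypePerm hp)) = Nat.card (CycleSet (τ.subtypePerm hq)) := by
  subst hστ hpq
  rfl

theorem cycleThrough_apply {D : Type u} (σ : Equiv.Perm D) (a : D) :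
    cycleThrough σ (σ a) = cycleThrough σ a :=
  Quotient.sound (Equiv.Perm.sameCycle_apply_left.2 (Equiv.Perm.SameCycle.refl _ _))

/-- The cycles of the restriction of a permutation to the union of a set of cycles. -/
noncomputable def cycleSetSubtypePermEquiv {D : Type u} (σ : Equiv.Perm D)
    (U : Set (CycleSet σ)) (h : ∀ a, cycleThrough σ (σ a) ∈ U ↔ cycleThrough σ a ∈ U) :
    CycleSet (σ.subtypePerm (p := fun a => cycleThrough σ a ∈ U) h) ≃ U :=
  Equiv.ofBijective
    (Quotient.lift (fun a => (⟨cycleThrough σ a.1, a.2⟩ : U)) (by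
      intro a b hab
      exact Subtype.ext (Quotient.sound (Equiv.Perm.sameCycle_subtypePerm.1 hab))))
    (by
      constructor
      · rintro ⟨a⟩ ⟨b⟩ hab
        exact Quotient.sound
          (Equiv.Perm.sameCycle_subtypePerm.2 (Quotient.exact (Subtype.ext_iff.1 hab)))
      · rintro ⟨⟨a⟩, ha⟩
        exact ⟨Quotient.mk _ ⟨a, ha⟩, rfl⟩)

/-! ### Blocks and weights of a merged partition. -/

namespace WeightedPartition

variable {D : Type u} {σ τ : Equiv.Perm D} (P : WeightedPartition (CycleSet σ)) (a b : D)

theorem arcLabel_eq_iff (c d : D) : P.arcLabel a b c = P.arcLabel a b d ↔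
    P.block (cycleThrough σ c) = P.block (cycleThrough σ d) ∨
      (P.block (cycleThrough σ c) = P.block (cycleThrough σ a) ∨
        P.block (cycleThrough σ c) = P.block (cycleThrough σ b)) ∧
      (P.block (cycleThrough σ d) = P.block (cycleThrough σ a) ∨
        P.block (cycleThrough σ d) = P.block (cycleThrough σ b)) := by
  unfold arcLabel
  split_ifs with h1 h2 h2
  · simp [h1, h2]
  · simp only [h2, and_false, or_false, false_iff]
    intro h3
    rw [h3] at h1
    exact h2 h1
  · simp only [h1, false_and, or_false, false_iff]
    intro h3
    rw [h3] at h1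
    exact h1 h2
  · simp [h1]

open scoped Classical in
theorem merge_block_eq_iff (h : τ = σ * Equiv.swap a b) (c d : D) :
    (P.merge a b h).block (cycleThrough τ c) = (P.merge a b h).block (cycleThrough τ d) ↔
      P.arcLabel a b c = P.arcLabel a b d :=
  Quotient.eq

open scoped Classical in
/-- The block of the merged partition that contains the arcs of a block. -/
noncomputable def mergeMap (h : τ = σ * Equiv.swap a b) : P.Block → (P.merge a b h).Block :=
  -- Arcs of one cycle of `σ` may lie on two cycles of `τ`, but these belong to the same merged
  -- block, because the label of an arc depends only on its block for `σ`.
  Quotient.lift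
    (Quotient.lift (fun c => (P.merge a b h).block (cycleThrough τ c)) (fun c d hcd =>
      (P.merge_block_eq_iff a b h c d).2 ((P.arcLabel_eq_iff a b c d).2
        (Or.inl (congrArg P.block (Quotient.sound hcd))))))
    (by
      rintro ⟨c⟩ ⟨d⟩ hcd
      exact (P.merge_block_eq_iff a b h c d).2 ((P.arcLabel_eq_iff a b c d).2
        (Or.inl (Quotient.sound hcd))))

open scoped Classical in
theorem mergeMap_surjective (h : τ = σ * Equiv.swap a b) :
    Function.Surjective (P.mergeMap a b h) := by
  rintro ⟨⟨c⟩⟩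
  exact ⟨P.block (cycleThrough σ c), rfl⟩

open scoped Classical in
theorem mergeMap_eq_iff (h : τ = σ * Equiv.swap a b) (p q : P.Block) :
    P.mergeMap a b h p = P.mergeMap a b h q ↔ p = q ∨
      (p = P.block (cycleThrough σ a) ∨ p = P.block (cycleThrough σ b)) ∧
      (q = P.block (cycleThrough σ a) ∨ q = P.block (cycleThrough σ b)) := by
  obtain ⟨⟨c⟩⟩ := p
  obtain ⟨⟨d⟩⟩ := q
  exact (P.merge_block_eq_iff a b h c d).trans (P.arcLabel_eq_iff a b c d)

open scoped Classical in
theorem merge_weight_mergeMap (h : τ = σ * Equiv.swap a b) (p : P.Block) :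
    (P.merge a b h).weight (P.mergeMap a b h p) =
      if p = P.block (cycleThrough σ a) ∨ p = P.block (cycleThrough σ b)
      then P.newWeight a b else P.weight p := by
  obtain ⟨⟨c⟩⟩ := p
  change (match P.arcLabel a b c with
      | none => P.newWeight a b
      | some β => P.weight β) = if P.block (cycleThrough σ c) = _ ∨
        P.block (cycleThrough σ c) = _ then _ else P.weight (P.block (cycleThrough σ c))
  unfold arcLabel
  split_ifs <;> rfl

theorem newWeight_eq
    [dec : Decidable (P.block (cycleThrough σ a) = P.block (cycleThrough σ b))] :
    P.newWeight a b = if P.block (cycleThrough σ a) = P.block (cycleThrough σ b)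
      then P.weight (P.block (cycleThrough σ a)) + 1
      else P.weight (P.block (cycleThrough σ a)) + P.weight (P.block (cycleThrough σ b)) := by
  unfold newWeight
  congr

end WeightedPartition

/-! ### Boundary components of the component subgraphs. -/

namespace RibbonGraph

/-- The pairing of arcs depends neither on the names of the edges nor on the rotation. -/
theorem mate_congr {D E E' : Type u} [Finite D] [Finite E] [Finite E'] {σ σ' : Equiv.Perm D}
    {ends : E × Bool ↪ D} {ends' : E' × Bool ↪ D} (j : E' ≃ E)
    (hj : ∀ x i, ends' (x, i) = ends (j x, i)) :
    (RibbonGraph.mk D E' σ' ends').mate = (RibbonGraph.mk D E σ ends).mate := by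
  set G := RibbonGraph.mk D E σ ends
  set G' := RibbonGraph.mk D E' σ' ends'
  ext a
  by_cases h : a ∈ Set.range ends'
  · obtain ⟨⟨x, i⟩, rfl⟩ := h
    have h1 : G'.mate (ends' (x, i)) = ends' (x, !i) := G'.mate_ends x i
    have h2 : G.mate (ends (j x, i)) = ends (j x, !i) := G.mate_ends (j x) i
    rw [h1, hj x i, h2, hj]
  · rw [G'.mate_of_notMem a h, G.mate_of_notMem a]
    rintro ⟨⟨x, i⟩, rfl⟩
    exact h ⟨(j.symm x, i), by rw [hj, Equiv.apply_symm_apply]⟩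

/-- The hypothesis on `U` says that no edge leaves `U`. -/
theorem vertexAt_mate (G : RibbonGraph.{u}) (U : Set G.Vertex)
    (hU : ∀ e, G.vertexAt (G.ends (e, false)) ∈ U ↔ G.vertexAt (G.ends (e, true)) ∈ U)
    (a : G.Arc) : G.vertexAt (G.mate a) ∈ U ↔ G.vertexAt a ∈ U := by
  by_cases h : a ∈ Set.range G.ends
  · obtain ⟨⟨x, i⟩, rfl⟩ := h
    rw [mate_ends]
    cases i <;> simp [hU]
  · rw [mate_of_notMem G a h]

theorem vertexAt_bdry (G : RibbonGraph.{u}) (U : Set G.Vertex)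
    (hU : ∀ e, G.vertexAt (G.ends (e, false)) ∈ U ↔ G.vertexAt (G.ends (e, true)) ∈ U)
    (a : G.Arc) : G.vertexAt (G.bdry a) ∈ U ↔ G.vertexAt a ∈ U := by
  rw [← G.vertexAt_mate U hU a]
  exact iff_of_eq (congrArg (· ∈ U) (cycleThrough_apply G.rot _))

/-- The boundary of a union of connected components. -/
theorem bdry_induce (G : RibbonGraph.{u}) (U : Set G.Vertex)
    (hU : ∀ e, G.vertexAt (G.ends (e, false)) ∈ U ↔ G.vertexAt (G.ends (e, true)) ∈ U) :
    (G.induce U).bdry = G.bdry.subtypePerm (G.vertexAt_bdry U hU) := by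
  -- An edge with one end in `U` has both ends there, so inducing on `U` turns no arc of `U` blank.
  have key : ∀ a : (G.induce U).Arc, ((G.induce U).mate a).1 = G.mate a.1 := by
    rintro ⟨a, ha⟩
    by_cases h : a ∈ Set.range G.ends
    · obtain ⟨⟨x, i⟩, rfl⟩ := h
      have hx : ∀ i, G.vertexAt (G.ends (x, i)) ∈ U := by
        have := hU x
        cases i <;> rintro (_ | _) <;> tauto
      have := (G.induce U).mate_ends ⟨x, hx⟩ i
      rw [mate_ends]
      exact congrArg Subtype.val this
    · refine (congrArg Subtype.val (mate_of_notMem (G.induce U) ⟨a, ha⟩ ?_)).trans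
        (mate_of_notMem G a h).symm
      rintro ⟨⟨x, i⟩, hx⟩
      exact h ⟨(x.1, i), congrArg Subtype.val hx⟩
  exact Equiv.ext fun a => Subtype.ext (congrArg G.rot (key a))

theorem component_vertexAt_ends (G : RibbonGraph.{u}) (P : WeightedPartition G.Vertex)
    (e : G.Edge) : (G.packaging P).component (P.block (G.vertexAt (G.ends (e, false)))) =
      (G.packaging P).component (P.block (G.vertexAt (G.ends (e, true)))) :=
  (G.packaging P).component_fst e

/-- A component is a union of connected parts of the surface, so its boundary is the restriction of
`bdry` to its arcs. Only `bdry` and this set of arcs matter; the rotations, hence the vertices, may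
differ. -/
theorem card_bdryComp_componentSubgraph_congr {D E E' : Type u} [Finite D] [Finite E] [Finite E']
    {σ σ' : Equiv.Perm D} {ends : E × Bool ↪ D} {ends' : E' × Bool ↪ D}
    (P : WeightedPartition (CycleSet σ)) (P' : WeightedPartition (CycleSet σ'))
    (c : ((RibbonGraph.mk D E σ ends).packaging P).Component)
    (c' : ((RibbonGraph.mk D E' σ' ends').packaging P').Component)
    (hb : (RibbonGraph.mk D E σ ends).bdry = (RibbonGraph.mk D E' σ' ends').bdry)
    (hc : ∀ a, ((RibbonGraph.mk D E σ ends).packaging P).component (P.block (cycleThrough σ a)) = c ↔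
      ((RibbonGraph.mk D E' σ' ends').packaging P').component
        (P'.block (cycleThrough σ' a)) = c') :
    Nat.card ((RibbonGraph.mk D E σ ends).componentSubgraph P c).BdryComp =
      Nat.card ((RibbonGraph.mk D E' σ' ends').componentSubgraph P' c').BdryComp := by
  unfold componentSubgraph BdryComp
  rw [bdry_induce _ _ fun e =>
      iff_of_eq (congrArg (· = _) (component_vertexAt_ends _ _ e)),
    bdry_induce _ _ fun e =>
      iff_of_eq (congrArg (· = _) (component_vertexAt_ends _ _ e))]
  exact card_cycleSet_subtypePerm_congr _ _ hb (funext fun a => propext (hc a))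

end RibbonGraph

/-! ### One factor of a summand. -/

namespace RibbonGraph

/-- The contribution of a ribbon graph with weighted partition of its vertices to a summand of the
packaged surface Tutte polynomial. -/
noncomputable def packagingTerm {R : Type*} [CommMonoid R] (G : RibbonGraph.{u})
    (P : WeightedPartition G.Vertex) (t : R) (z : ℚ → R) : R :=
  t ^ (G.packaging P).nullity * ∏ᶠ c : (G.packaging P).Component, z (G.genusIndex P c)

variable {R : Type*} [CommMonoid R] {D E E' : Type u} [Finite D] [Finite E] [Finite E']
  {σ τ : Equiv.Perm D} {ends : E × Bool ↪ D} {ends' : E' × Bool ↪ D}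

theorem genusIndex_congr {G G' : RibbonGraph.{u}} {P : WeightedPartition G.Vertex}
    {P' : WeightedPartition G'.Vertex} {c : (G.packaging P).Component}
    {c' : (G'.packaging P').Component}
    (h : ((G.packaging P).numEdges c : ℚ) - (G.packaging P).numVertices c
        + (G.packaging P).totalWeight c =
      (G'.packaging P').numEdges c' - (G'.packaging P').numVertices c'
        + (G'.packaging P').totalWeight c')
    (hf : Nat.card (G.componentSubgraph P c).BdryComp =
      Nat.card (G'.componentSubgraph P' c').BdryComp) :
    G.genusIndex P c = G'.genusIndex P' c' := by
  rw [genusIndex, genusIndex, hf]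
  linarith

/-- Invariance under renaming of edges. It handles the factor in which `e` does not occur, whose
edges form different subtypes before and after the operation. -/
theorem packagingTerm_congr (j : E' ≃ E) (hj : ∀ x i, ends' (x, i) = ends (j x, i))
    (P : WeightedPartition (CycleSet σ)) (t : R) (z : ℚ → R) :
    (RibbonGraph.mk D E σ ends).packagingTerm P t z =
      (RibbonGraph.mk D E' σ ends').packagingTerm P t z := by
  set G := RibbonGraph.mk D E σ ends with hG
  set G' := RibbonGraph.mk D E' σ ends' with hG'
  set K := G.packaging P with hK
  set K' := G'.packaging P with hK'
  have hfst : ∀ x : E', K'.fst x = K.fst (j x) := fun x =>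
    congrArg (fun a => P.block (cycleThrough σ a)) (hj x false)
  have hsnd : ∀ x : E', K'.snd x = K.snd (j x) := fun x =>
    congrArg (fun a => P.block (cycleThrough σ a)) (hj x true)
  let φ : K.Component ≃ K'.Component := Quot.congr (Equiv.refl P.Block) (by
    intro p q
    constructor
    · rintro ⟨x, rfl, rfl⟩
      exact ⟨j.symm x, (hfst _).trans (congrArg K.fst (j.apply_symm_apply x)),
        (hsnd _).trans (congrArg K.snd (j.apply_symm_apply x))⟩
    · rintro ⟨x, hp, hq⟩
      exact ⟨j x, (hfst x).symm.trans hp, (hsnd x).symm.trans hq⟩)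
  have hφ : ∀ p : P.Block, K'.component p = φ (K.component p) := fun _ => rfl
  have hcomp : ∀ (p : P.Block) c, K.component p = c ↔ K'.component p = φ c := fun p c => by
    rw [hφ, EmbeddingLike.apply_eq_iff_eq]
  have hnull : K.nullity = K'.nullity := by
    have h1 : Nat.card K.Edge = Nat.card K'.Edge := Nat.card_congr j.symm
    have h2 : Nat.card K.Vertex = Nat.card K'.Vertex := rfl
    rw [WeightedMultigraph.nullity, WeightedMultigraph.nullity, h1, h2, Nat.card_congr φ]
  have hgenus : ∀ c, G.genusIndex P c = G'.genusIndex P (φ c) := by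
    intro c
    have h1 : K.numEdges c = K'.numEdges (φ c) :=
      (Nat.card_congr (j.subtypeEquiv fun x =>
        (iff_of_eq (congrArg (K'.component · = φ c) (hfst x))).trans (hcomp _ c).symm)).symm
    have h2 : K.numVertices c = K'.numVertices (φ c) :=
      Nat.card_congr (Equiv.subtypeEquivRight fun p => hcomp p c)
    have h3 : K.totalWeight c = K'.totalWeight (φ c) :=
      finsum_eq_of_bijective _ (Equiv.subtypeEquivRight fun p => hcomp p c).bijective
        fun _ => rfl
    have h4 := card_bdryComp_componentSubgraph_congr (ends := ends) (ends' := ends') P P c (φ c)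
      (congrArg (σ * ·) (mate_congr j hj).symm) (fun a => hcomp _ c)
    refine genusIndex_congr ?_ h4
    change (K.numEdges c : ℚ) - K.numVertices c + K.totalWeight c = _
    rw [h1, h2, h3]
  rw [packagingTerm, packagingTerm, hnull]
  congr 1
  exact finprod_eq_of_bijective φ φ.bijective fun c => by rw [hgenus]

open scoped Classical in
-- Multiplying the rotation by the transposition of the two arcs of `e` merges the blocks at its
-- ends, and this is contraction of `e` in the packaging, whether the vertices themselves split or
-- join.
theorem isContraction_packaging (e : E) (j : E' ≃ ↥({e}ᶜ : Set E))
    (hj : ∀ x i, ends' (x, i) = ends ((j x).1, i)) (P : WeightedPartition (CycleSet σ))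
    (h : τ = σ * Equiv.swap (ends (e, false)) (ends (e, true))) :
    WeightedMultigraph.IsContraction ((RibbonGraph.mk D E σ ends).packaging P)
      ((RibbonGraph.mk D E' τ ends').packaging (P.merge _ _ h)) e (P.mergeMap _ _ h) j where
  surj := P.mergeMap_surjective _ _ h
  vmap_eq_iff := P.mergeMap_eq_iff _ _ h
  fst_eq x := congrArg (fun a => (P.merge _ _ h).block (cycleThrough τ a)) (hj x false)
  snd_eq x := congrArg (fun a => (P.merge _ _ h).block (cycleThrough τ a)) (hj x true)
  weight_eq p hp hq := (P.merge_weight_mergeMap _ _ h p).trans (if_neg (not_or.2 ⟨hp, hq⟩))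
  weight_new := (P.merge_weight_mergeMap _ _ h _).trans ((if_pos (Or.inl rfl)).trans
    (P.newWeight_eq _ _ (dec := Classical.propDecidable _)))

open scoped Classical in
-- The transposition that leaves `mate` is absorbed by the rotation.
theorem bdry_eq_of_contract (e : E) (j : E' ≃ ↥({e}ᶜ : Set E))
    (hj : ∀ x i, ends' (x, i) = ends ((j x).1, i))
    (h : τ = σ * Equiv.swap (ends (e, false)) (ends (e, true))) :
    (RibbonGraph.mk D E σ ends).bdry = (RibbonGraph.mk D E' τ ends').bdry := by
  subst h
  rw [← bdry_contract _ e]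
  exact congrArg (σ * Equiv.swap (ends (e, false)) (ends (e, true)) * ·)
    (mate_congr (ends := (RibbonGraph.mk D E σ ends).endsOn {e}ᶜ) j hj).symm

/-- A pair has one or two elements, so the truncated subtraction is exact. -/
theorem two_sub_ncard_pair {X : Type*} (p q : X) [dec : Decidable (p = q)] :
    2 - Set.ncard {p, q} = if p = q then 1 else 0 := by
  split_ifs with he
  · rw [he, Set.pair_eq_singleton, Set.ncard_singleton]
  · rw [Set.ncard_pair he]

/-- Two minus the number of blocks that contain an end vertex of an edge. -/
theorem ncard_incident_blocks (G : RibbonGraph.{u}) (P : WeightedPartition G.Vertex) (e : G.Edge)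
    [dec : Decidable ((G.packaging P).fst e = (G.packaging P).snd e)] :
    2 - Set.ncard {β : P.Block | ∃ w : G.Vertex, G.Incident w e ∧ P.block w = β} =
      if (G.packaging P).fst e = (G.packaging P).snd e then 1 else 0 := by
  have : {β : P.Block | ∃ w : G.Vertex, G.Incident w e ∧ P.block w = β} =
      {(G.packaging P).fst e, (G.packaging P).snd e} := by
    ext β
    constructor
    · rintro ⟨_, ⟨_ | _, rfl⟩, rfl⟩
      · exact Or.inl rfl
      · exact Or.inr rfl
    · rintro (rfl | rfl)
      · exact ⟨_, ⟨false, rfl⟩, rfl⟩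
      · exact ⟨_, ⟨true, rfl⟩, rfl⟩
  rw [this]
  exact two_sub_ncard_pair (X := P.Block) _ _ (dec := dec)

open scoped Classical in
-- The rotation `σ` is arbitrary so that the lemma applies with `rot` for contraction and with
-- `bdry` for deletion.
theorem packagingTerm_contract (e : E) (j : E' ≃ ↥({e}ᶜ : Set E))
    (hj : ∀ x i, ends' (x, i) = ends ((j x).1, i)) (P : WeightedPartition (CycleSet σ))
    (h : τ = σ * Equiv.swap (ends (e, false)) (ends (e, true))) (t : R) (z : ℚ → R) :
    (RibbonGraph.mk D E σ ends).packagingTerm P t z =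
      t ^ (2 - Set.ncard {β : P.Block | ∃ w : CycleSet σ,
        (RibbonGraph.mk D E σ ends).Incident w e ∧ P.block w = β}) *
      (RibbonGraph.mk D E' τ ends').packagingTerm (P.merge _ _ h) t z := by
  have hc := isContraction_packaging e j hj P h
  have hb := bdry_eq_of_contract e j hj h
  set G := RibbonGraph.mk D E σ ends with hG
  set G' := RibbonGraph.mk D E' τ ends' with hG'
  have : Finite (G.packaging P).Vertex := inferInstanceAs (Finite P.Block)
  have : Finite (G.packaging P).Edge := inferInstanceAs (Finite E)
  have hgenus : ∀ c, G.genusIndex P c = G'.genusIndex (P.merge _ _ h) (hc.componentEquiv c) := by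
    intro c
    have h1 := hc.genus_eq c
    have h2 := card_bdryComp_componentSubgraph_congr P (P.merge _ _ h) c (hc.componentEquiv c) hb
      (fun a => hc.componentEquiv.injective.eq_iff.symm)
    exact genusIndex_congr h1 h2
  rw [packagingTerm, packagingTerm, ← mul_assoc, ← pow_add, hc.nullity_eq,
    ← ncard_incident_blocks]
  congr 1
  exact finprod_eq_of_bijective hc.componentEquiv hc.componentEquiv.bijective
    fun c => by rw [hgenus]

/-- The contribution of a ribbon graph without edges. -/
theorem packagingTerm_of_isEmpty (G : RibbonGraph.{u}) [IsEmpty G.Edge]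
    (P : WeightedPartition G.Vertex) (t : R) (z : ℚ → R) :
    G.packagingTerm P t z =
      ∏ᶠ β : P.Block, z ((1 - (P.size β : ℚ) + (P.weight β : ℚ)) / 2) := by
  have hE : IsEmpty (G.packaging P).Edge := inferInstanceAs (IsEmpty G.Edge)
  -- Without edges every block is a component of its own.
  let φ : P.Block ≃ (G.packaging P).Component :=
    { toFun := (G.packaging P).component
      invFun := Quot.lift id (by rintro _ _ ⟨x, -⟩; exact isEmptyElim x)
      left_inv := fun _ => rfl
      right_inv := by rintro ⟨p⟩; rfl }
  have hφ : ∀ (p β : P.Block), (G.packaging P).component p = φ β ↔ p = β := fun p β =>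
    φ.injective.eq_iff
  have hnull : (G.packaging P).nullity = 0 := by
    have h1 : Nat.card (G.packaging P).Vertex = Nat.card (G.packaging P).Component :=
      Nat.card_congr φ
    rw [WeightedMultigraph.nullity, h1, Nat.card_of_isEmpty, zero_add, Nat.sub_self]
  rw [packagingTerm, hnull, pow_zero, one_mul]
  refine (finprod_eq_of_bijective φ φ.bijective fun β => ?_).symm
  congr 1
  have h1 : (G.packaging P).numEdges (φ β) = 0 := Nat.card_of_isEmpty
  have h2 : (G.packaging P).numVertices (φ β) = 1 := by
    have : Nat.card {p : P.Block // p = β} = 1 := by simp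
    exact (Nat.card_congr (Equiv.subtypeEquivRight fun p => hφ p β)).trans this
  have h3 : (G.packaging P).totalWeight (φ β) = P.weight β := by
    refine (finsum_eq_of_bijective (Equiv.subtypeEquivRight fun p => hφ p β)
      (Equiv.bijective _) (g := fun p : {p : P.Block // p = β} => P.weight p.1)
      fun _ => rfl).trans ?_
    exact finsum_unique _
  have h4 : Nat.card (G.componentSubgraph P (φ β)).BdryComp = P.size β := by
    -- Without edges the boundary runs along the vertex circles, so `f` counts the vertices in the
    -- block.
    have hm : (G.componentSubgraph P (φ β)).mate = 1 :=
      Equiv.ext fun a => mate_of_notMem _ a (by rintro ⟨⟨x, i⟩, -⟩; exact isEmptyElim x.1)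
    rw [BdryComp, bdry, hm, mul_one]
    refine (Nat.card_congr (cycleSetSubtypePermEquiv G.rot
      {w | (G.packaging P).component (P.block w) = φ β} fun a => by
        rw [cycleThrough_apply])).trans ?_
    exact Nat.card_congr (Equiv.subtypeEquivRight fun w => hφ (P.block w) β)
  rw [genusIndex, h1, h2, h3, h4]
  push_cast
  ring

end RibbonGraph

/-! ### Splitting the sum according to whether the subset contains the edge. -/

theorem finsum_set_split {E M : Type*} [Finite E] [AddCommMonoid M] (e : E) (f : Set E → M) :
    ∑ᶠ A, f A = ∑ᶠ A : Set ↥({e}ᶜ : Set E), f (Subtype.val '' A) +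
      ∑ᶠ A : Set ↥({e}ᶜ : Set E), f (insert e (Subtype.val '' A)) := by
  classical
  have := Fintype.ofFinite (Set E)
  have := Fintype.ofFinite (Set ↥({e}ᶜ : Set E))
  rw [finsum_eq_sum_of_fintype, finsum_eq_sum_of_fintype, finsum_eq_sum_of_fintype]
  let φ : Set ↥({e}ᶜ : Set E) ⊕ Set ↥({e}ᶜ : Set E) → Set E :=
    Sum.elim (fun A => Subtype.val '' A) (fun A => insert e (Subtype.val '' A))
  have hmem : ∀ A : Set ↥({e}ᶜ : Set E), e ∉ Subtype.val '' A := by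
    rintro A ⟨x, -, hx⟩
    exact x.2 hx
  have hinj : Function.Injective
      (fun A : Set ↥({e}ᶜ : Set E) => (Subtype.val '' A : Set E)) :=
    Subtype.val_injective.image_injective
  have hφ : Function.Bijective φ := by
    constructor
    · rintro (A | A) (B | B) h
      · exact congrArg Sum.inl (hinj h)
      · exact absurd ((Set.ext_iff.1 h e).2 (Set.mem_insert _ _)) (hmem A)
      · exact absurd ((Set.ext_iff.1 h e).1 (Set.mem_insert _ _)) (hmem B)
      · refine congrArg Sum.inr (hinj ?_)
        have := congrArg (· \ {e}) h
        simpa [φ, hmem] using this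
    · intro B
      have h1 : Subtype.val '' (Subtype.val ⁻¹' B : Set ↥({e}ᶜ : Set E)) = B \ {e} := by
        rw [Subtype.image_preimage_coe, Set.sdiff_eq, Set.inter_comm]
      by_cases he : e ∈ B
      · refine ⟨Sum.inr (Subtype.val ⁻¹' B), ?_⟩
        change insert e (Subtype.val '' _) = B
        rw [h1, Set.insert_sdiff_singleton, Set.insert_eq_of_mem he]
      · refine ⟨Sum.inl (Subtype.val ⁻¹' B), ?_⟩
        change Subtype.val '' _ = B
        rw [h1, Set.sdiff_singleton_eq_self he]
  rw [← Function.Bijective.sum_comp hφ f, Fintype.sum_sum_type]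
  rfl

section

variable {E : Type u} {e : E} {B : Set E} {B' : Set ↥({e}ᶜ : Set E)}

/-- A set that avoids `e`, as a set of elements different from `e`. -/
def equivOfNotMem (h : ∀ x, x.1 ∈ B ↔ x ∈ B') (he : e ∉ B) : ↥B' ≃ ↥B where
  toFun x := ⟨x.1.1, (h x.1).2 x.2⟩
  invFun y := ⟨⟨y.1, fun hy => he (hy ▸ y.2)⟩, (h _).1 y.2⟩
  left_inv _ := rfl
  right_inv _ := rfl

/-- The elements different from `e` of a set that contains `e`. -/
def equivOfMem (h : ∀ x, x.1 ∈ B ↔ x ∈ B') (he : e ∈ B) :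
    ↥B' ≃ ↥({⟨e, he⟩}ᶜ : Set ↥B) where
  toFun x := ⟨⟨x.1.1, (h x.1).2 x.2⟩, fun hx => x.1.2 (congrArg Subtype.val hx)⟩
  invFun y := ⟨⟨y.1.1, fun hy => y.2 (Subtype.ext hy)⟩, (h _).1 y.1.2⟩
  left_inv _ := rfl
  right_inv _ := rfl

end

/-! ### The recursion and the edgeless case. -/

namespace RibbonGraph

/-- Needed for the face partition of a contraction, which is transported along the equality of two
boundary permutations. -/
theorem packagingTerm_cast {R : Type*} [CommMonoid R] {D E E' : Type u} [Finite D] [Finite E]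
    [Finite E'] {σ τ : Equiv.Perm D} {ends : E × Bool ↪ D} {ends' : E' × Bool ↪ D} (j : E' ≃ E)
    (hj : ∀ x i, ends' (x, i) = ends (j x, i)) (h : σ = τ) (P : WeightedPartition (CycleSet σ))
    (t : R) (z : ℚ → R) :
    (RibbonGraph.mk D E σ ends).packagingTerm P t z =
      (RibbonGraph.mk D E' τ ends').packagingTerm
        (cast (congrArg (fun σ : Equiv.Perm D => WeightedPartition (CycleSet σ)) h) P) t z := by
  subst h
  exact packagingTerm_congr j hj P t z

end RibbonGraph

namespace PackagedRibbonGraph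

open RibbonGraph

theorem tutte_eq_finsum (P : PackagedRibbonGraph.{u}) :
    P.tutte = ∑ᶠ A : Set P.graph.Edge,
      (P.graph.dual.restrict Aᶜ).packagingTerm P.face (MvPolynomial.X TutteVar.x)
        (fun i => (MvPolynomial.X (TutteVar.xIdx i) : MvPolynomial TutteVar ℤ)) *
      (P.graph.restrict A).packagingTerm P.vert (MvPolynomial.X TutteVar.y)
        (fun i => MvPolynomial.X (TutteVar.yIdx i)) := by
  exact finsum_congr fun A => (mul_assoc _ _ _).trans (mul_mul_mul_comm _ _ _ _)

theorem tutte_eq_delete_add_contract (P : PackagedRibbonGraph.{u}) (e : P.graph.Edge) :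
    P.tutte = MvPolynomial.X TutteVar.x ^ (2 - P.eta e) * (P.delete e).tutte +
      MvPolynomial.X TutteVar.y ^ (2 - P.mu e) * (P.contract e).tutte := by
  rw [tutte_eq_finsum, finsum_set_split e, tutte_eq_finsum, tutte_eq_finsum]
  rw [mul_finsum, mul_finsum]
  have himg : ∀ (A : Set ↥({e}ᶜ : Set P.graph.Edge)) x, x.1 ∈ Subtype.val '' A ↔ x ∈ A :=
    fun A x => Subtype.val_injective.mem_set_image
  have hmem : ∀ A : Set ↥({e}ᶜ : Set P.graph.Edge), e ∉ Subtype.val '' A := by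
    rintro A ⟨x, -, hx⟩
    exact x.2 hx
  have hins : ∀ (A : Set ↥({e}ᶜ : Set P.graph.Edge)) x,
      x.1 ∈ insert e (Subtype.val '' A) ↔ x ∈ A :=
    fun A x => (Set.mem_insert_iff.trans (or_iff_right x.2)).trans (himg A x)
  congr 1
  · refine finsum_congr fun A => ?_
    rw [← mul_assoc]
    congr 1
    -- Here `e ∈ Aᶜ` is an edge of the restricted dual. Its end vertices there are the boundary
    -- components that meet `e`, so the exponent is `2 - η(e)`.
    · exact packagingTerm_contract (D := P.graph.Arc) (σ := P.graph.bdry)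
        (τ := (P.graph.delete e).bdry) (ends := P.graph.endsOn (Subtype.val '' A)ᶜ)
        (ends' := (P.graph.delete e).endsOn Aᶜ) (⟨e, hmem A⟩ : ↥(Subtype.val '' A)ᶜ)
        (equivOfMem (fun x => not_congr (himg A x)) (hmem A)) (fun _ _ => rfl) P.face
        (P.graph.bdry_delete e) _ _
    · exact packagingTerm_congr (D := P.graph.Arc) (σ := P.graph.rot)
        (ends := P.graph.endsOn (Subtype.val '' A)) (ends' := (P.graph.delete e).endsOn A)
        (equivOfNotMem (himg A) (hmem A)) (fun _ _ => rfl) P.vert _ _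
  · refine finsum_congr fun A => ?_
    rw [mul_left_comm]
    congr 1
    · exact packagingTerm_cast (D := P.graph.Arc) (σ := P.graph.bdry)
        (τ := (P.graph.contract e).bdry)
        (ends := P.graph.endsOn (insert e (Subtype.val '' A))ᶜ)
        (ends' := (P.graph.contract e).endsOn Aᶜ)
        (equivOfNotMem (fun x => not_congr (hins A x)) (fun h => h (Set.mem_insert _ _)))
        (fun _ _ => rfl) (P.graph.bdry_contract e).symm P.face _ _
    -- Here `e` is an edge of the restricted graph itself, with exponent `2 - μ(e)`.
    · exact packagingTerm_contract (D := P.graph.Arc) (σ := P.graph.rot)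
        (τ := (P.graph.contract e).rot) (ends := P.graph.endsOn (insert e (Subtype.val '' A)))
        (ends' := (P.graph.contract e).endsOn A) (⟨e, Set.mem_insert _ _⟩ : ↥(insert e (Subtype.val '' A)))
        (equivOfMem (hins A) (Set.mem_insert _ _)) (fun _ _ => rfl) P.vert rfl _ _

theorem tutte_of_isEmpty (P : PackagedRibbonGraph.{u}) [IsEmpty P.graph.Edge] :
    P.tutte =
      (∏ᶠ β : P.face.Block, MvPolynomial.X
        (TutteVar.xIdx ((1 - (P.face.size β : ℚ) + (P.face.weight β : ℚ)) / 2))) *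
      (∏ᶠ β : P.vert.Block, MvPolynomial.X
        (TutteVar.yIdx ((1 - (P.vert.size β : ℚ) + (P.vert.weight β : ℚ)) / 2))) := by
  -- The empty edge set has a single subset, `default`.
  rw [tutte_eq_finsum, finsum_unique]
  have h1 : IsEmpty (P.graph.restrict default).Edge :=
    ⟨fun x => isEmptyElim (α := P.graph.Edge) x.1⟩
  have h2 : IsEmpty (P.graph.dual.restrict defaultᶜ).Edge :=
    ⟨fun x => isEmptyElim (α := P.graph.Edge) x.1⟩
  exact congrArg₂ (· * ·) (packagingTerm_of_isEmpty (P.graph.dual.restrict defaultᶜ) P.face _ _)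
    (packagingTerm_of_isEmpty (P.graph.restrict default) P.vert _ _)

end PackagedRibbonGraph

theorem theorem3p2 (P : PackagedRibbonGraph.{u}) :
    (∀ e : P.graph.Edge,
      P.tutte =
        MvPolynomial.X TutteVar.x ^ (2 - P.eta e) * (P.delete e).tutte +
        MvPolynomial.X TutteVar.y ^ (2 - P.mu e) * (P.contract e).tutte) ∧
    (IsEmpty P.graph.Edge →
      P.tutte =
        (∏ᶠ β : P.face.Block, MvPolynomial.X
          (TutteVar.xIdx ((1 - (P.face.size β : ℚ) + (P.face.weight β : ℚ)) / 2))) *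
        (∏ᶠ β : P.vert.Block, MvPolynomial.X
          (TutteVar.yIdx ((1 - (P.vert.size β : ℚ) + (P.vert.weight β : ℚ)) / 2)))) := by
  exact ⟨P.tutte_eq_delete_add_contract, fun _ => P.tutte_of_isEmpty⟩
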